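/- Let $G$ be a finite abelian group and let $G\cong\bigoplus_{j}(\mathbb{Z}/p_j^{r_j})^{d_j}$ (finite sum) be its prime-power decomposition, where the $p_j$ are primes (not necessarily distinct), $r_j\ge 1$, and the pairs $(p_j,r_j)$ are pairwise distinct. Let $k\ge 1$ be an integer. Suppose that some summand $\mathbb{Z}/p_j^{r_j}$ has multiplicity $d_j=1$, where either $p_j=2$ (and $k\ge 1$ is arbitrary), or $p_j=3$ and $k$ is odd. Then the restricted wreath product $G\wr\mathbb{Z}^k=\bigl(\bigoplus_{x\in\mathbb{Z}^k}G\bigr)\rtimes\mathbb{Z}^k$, with $\mathbb{Z}^k$ acting by shifting the coordinates, has the $R_\infty$ property: for every automorphism $\varphi$ of $\Gamma=G\wr\mathbb{Z}^k$ the Reidemeister number $R(\varphi)$, i.e. the number of classes of the equivalence relation $x\sim g\,x\,\varphi(g^{-1})$ $(g\in\Gamma)$ on $\Gamma$, is infinite. -/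

import Mathlib

open scoped DirectSum

/-- Twisted conjugacy with respect to an automorphism `φ`: the equivalence relation
`x ∼ g * x * φ (g⁻¹)`. Its classes are the Reidemeister classes of `φ`. -/
def reidemeisterSetoid {Γ : Type*} [Group Γ] (φ : Γ ≃* Γ) : Setoid Γ where
  r x y := ∃ g : Γ, y = g * x * φ g⁻¹
  iseqv :=
    { refl := fun x => ⟨1, by simp⟩
      symm := by
        rintro x y ⟨g, rfl⟩
        exact ⟨g⁻¹, by simp [mul_assoc]⟩
      trans := by
        rintro x y z ⟨g, rfl⟩ ⟨h, rfl⟩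
        exact ⟨h * g, by simp [mul_assoc]⟩ }

/-- The Reidemeister number of `φ`: the number (possibly `∞`) of its Reidemeister classes. -/
noncomputable def reidemeisterNumber {Γ : Type*} [Group Γ] (φ : Γ ≃* Γ) : ℕ∞ :=
  ENat.card (Quotient (reidemeisterSetoid φ))

/-- The property `R_∞`: every automorphism has infinite Reidemeister number. -/
def HasRInfty (Γ : Type*) [Group Γ] : Prop :=
  ∀ φ : Γ ≃* Γ, reidemeisterNumber φ = ⊤

/-- The shift action of an additive group `A` on `⊕_{x ∈ A} G`: the element `x` takes the copy
of `G` at `y` to the copy of `G` at `x + y`. -/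
noncomputable def shiftAction (G A : Type*) [AddCommGroup G] [AddCommGroup A] :
    Multiplicative A →* MulAut (Multiplicative (A →₀ G)) where
  toFun x := AddEquiv.toMultiplicative (Finsupp.domCongr (Equiv.addLeft x.toAdd))
  map_one' := by
    ext f a
    simp [Finsupp.domCongr, Finsupp.equivMapDomain_apply, ← Equiv.Perm.inv_def]
  map_mul' x y := by
    ext f a
    simp [Finsupp.domCongr, Finsupp.equivMapDomain_apply, ← Equiv.Perm.inv_def, add_assoc]

theorem shiftAction_single (G A : Type*) [AddCommGroup G] [AddCommGroup A] (x y : A) (g : G) :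
    shiftAction G A (Multiplicative.ofAdd x) (Multiplicative.ofAdd (Finsupp.single y g)) =
      Multiplicative.ofAdd (Finsupp.single (x + y) g) := by
  simp [shiftAction, Finsupp.domCongr]

/-- The restricted wreath product `G ≀ A = (⊕_{x ∈ A} G) ⋊ A` of (additively written) abelian
groups `G` and `A`, with `A` acting by shifts. -/
abbrev RestrictedWreath (G A : Type*) [AddCommGroup G] [AddCommGroup A] : Type _ :=
  SemidirectProduct (Multiplicative (A →₀ G)) (Multiplicative A) (shiftAction G A)

namespace RInfty

/-! Suppose `φ` has finitely many Reidemeister classes. It preserves the torsion part `A = ⊕ G`,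
acting there by `f` and on `ℤ^k` by an automorphism `M`. Then `1 - M` has finite cokernel, so it is
injective, and from this `1 - f` has finite cokernel on `A` too.

Take `p = p_j` and `s + 1 = r_j` for the summand of multiplicity one, and put `B = A[p^(s+1)] + pA`.
Multiplicity one makes the Ulm quotient `B / (A[p^s] + pA)` a copy of `𝔽_p[ℤ^k]`
(`exists_ulm_character`). There `f` becomes `z ↦ u * M z` with `u` a unit (`toAlgebra_semilinear`),
and all units are monomials `c x^v` (`eq_single_of_mul_eq_one`). So `f` permutes the basis by `T z =
M z + v`, up to the sign `c`.

`T` has infinitely many orbits whose periods `j` all satisfy `c ^ j = 1`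
(`exists_orbit_representatives`, `exists_point_with_sign_period`). Each carries an `f`-invariant
functional, so `(1 - f) B` has infinite index in `B`. But finiteness of the cokernel passes from `A`
to `B` (`relIndex_map_oneSub_ne_zero`), a contradiction. -/

/-! ### Integer matrices of odd order, and the content of a lattice vector. -/

theorem det_one_sub_eq_zero_of_odd_pow {k l : ℕ} (hk : Odd k) (hl : Odd l)
    (A : Matrix (Fin k) (Fin k) ℤ) (hA : A ^ l = 1) : (1 - A).det = 0 := by
  have hdet : A.det = 1 := by
    have h1 : A.det ^ l = 1 := by rw [← Matrix.det_pow, hA, Matrix.det_one]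
    exact (pow_eq_one_iff_of_ne_zero hl.pos.ne').1 h1 |>.resolve_right
      fun h => (Nat.not_even_iff_odd.2 hl) h.2
  let B : Matrix (Fin k) (Fin k) ℝ := (Int.castRingHom ℝ).mapMatrix A
  have hB : B ^ l = 1 := by rw [← map_pow, hA, map_one]
  have hBdet : B.det = 1 := by
    rw [← RingHom.map_det, hdet, map_one]
  -- Negative at `0` because `k` is odd and `det = 1`; hence there is a real eigenvalue `x ≥ 0`, and
  -- `x ^ l = 1` forces `x = 1`.
  have h0 : B.charpoly.eval 0 = -1 := by
    rw [Matrix.eval_charpoly]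
    simp [Matrix.det_neg, hBdet, hk.neg_one_pow]
  have hdeg : 0 < B.charpoly.degree := by
    rw [Matrix.charpoly_degree_eq_dim]
    simpa using hk.pos
  have htop := Polynomial.tendsto_atTop_of_leadingCoeff_nonneg B.charpoly hdeg
    (by rw [B.charpoly_monic.leadingCoeff]; exact zero_le_one)
  obtain ⟨t, ht, ht0⟩ := ((htop.eventually_ge_atTop 0).and
    (Filter.eventually_ge_atTop (0 : ℝ))).exists
  obtain ⟨x, hx, hx0⟩ := intermediate_value_Icc ht0 B.charpoly.continuous.continuousOn
    (show (0 : ℝ) ∈ Set.Icc _ _ from ⟨by rw [h0]; norm_num, ht⟩)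
  have hx1 : x = 1 := by
    simp only [Matrix.eval_charpoly] at hx0
    obtain ⟨u, hu, hux⟩ := Matrix.exists_mulVec_eq_zero_iff.2 hx0
    have hu1 : B.mulVec u = x • u := by
      rw [Matrix.sub_mulVec, sub_eq_zero] at hux
      rw [← hux]; simp [Matrix.scalar_apply]
    have hpow : ∀ n : ℕ, (B ^ n).mulVec u = x ^ n • u := by
      intro n
      induction n with
      | zero => simp
      | succ n ih => rw [pow_succ', ← Matrix.mulVec_mulVec, ih, Matrix.mulVec_smul, hu1,
          smul_smul, pow_succ]
    have h1 := hpow l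
    rw [hB, Matrix.one_mulVec] at h1
    have h2 : x ^ l = 1 := by
      by_contra hne
      apply hu
      have h3 : (x ^ l - 1) • u = 0 := by rw [sub_smul, ← h1, one_smul, sub_self]
      exact (smul_eq_zero.1 h3).resolve_left (sub_ne_zero.2 hne)
    exact (pow_eq_one_iff_of_nonneg hx.1 hl.pos.ne').1 h2
  rw [hx1] at hx0
  simp only [Matrix.eval_charpoly, map_one] at hx0
  have h4 : ((1 - A).det : ℝ) = (1 - B).det := by
    have := RingHom.map_det (Int.castRingHom ℝ) (1 - A)
    rw [map_sub, map_one] at this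
    exact this
  rw [hx0] at h4
  exact_mod_cast h4

/-- The gcd of the coordinates is invariant under automorphisms of the lattice and scales with
natural multiples. -/
theorem eq_of_nsmul_eq_nsmul_map {k : ℕ} (N : (Fin k → ℤ) ≃+ (Fin k → ℤ)) {x : Fin k → ℤ}
    (hx : x ≠ 0) {a b : ℕ} (h : a • x = b • N x) : a = b := by
  let content (y : Fin k → ℤ) : ℤ := Finset.univ.gcd y
  have hle : ∀ (N : (Fin k → ℤ) ≃+ (Fin k → ℤ)) (y), content y ∣ content (N y) := by
    intro N y
    refine Finset.dvd_gcd fun i _ => ?_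
    have : ∀ i, ∃ z, y i = content y * z := fun i => Finset.gcd_dvd (Finset.mem_univ i)
    choose z hz using this
    have hy : y = content y • z := by ext i; simpa using hz i
    conv_rhs => rw [hy, map_zsmul]
    simp
  have hN : content (N x) = content x := by
    have h1 := hle N x
    have h2 := hle N.symm (N x)
    rw [AddEquiv.symm_apply_apply] at h2
    have h3 := associated_of_dvd_dvd h1 h2
    have h4 := h3.symm
    rwa [← normalize_eq_normalize_iff_associated, Finset.normalize_gcd, Finset.normalize_gcd] at h4
  have hs : ∀ (n : ℕ) (y : Fin k → ℤ), content (n • y) = n * content y := by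
    intro n y
    have : n • y = fun i => (n : ℤ) * y i := by ext i; simp
    simp only [content, this]
    rw [Finset.gcd_mul_left]
    simp [Int.normalize_coe_nat]
  have h5 := congrArg content h
  rw [hs, hs, hN] at h5
  have h6 : content x ≠ 0 := by
    intro h0
    rw [Finset.gcd_eq_zero_iff] at h0
    exact hx (funext fun i => h0 i (Finset.mem_univ i))
  exact_mod_cast mul_right_cancel₀ h6 h5

/-! ### Orbits and periods of affine lattice permutations. -/

section Lattice

variable {k : ℕ} (M : (Fin k → ℤ) ≃+ (Fin k → ℤ))

/-- The endomorphism `1 - f` of an additive group. -/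
def oneSub {A : Type*} [AddCommGroup A] (f : A →+ A) : A →+ A := AddMonoidHom.id A - f

@[simp] theorem oneSub_apply {A : Type*} [AddCommGroup A] (f : A →+ A) (a : A) :
    oneSub f a = a - f a := rfl

theorem exists_right_quasi_inverse (D : (Fin k → ℤ) →+ (Fin k → ℤ)) (hD : D.range.FiniteIndex) :
    ∃ (n : ℕ) (E : (Fin k → ℤ) →+ (Fin k → ℤ)), 0 < n ∧ ∀ z, D (E z) = n • z := by
  have h : ∀ i : Fin k, ∃ y, D y = D.range.index • (Pi.single i (1 : ℤ) : Fin k → ℤ) :=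
    fun i => AddSubgroup.nsmul_index_mem D.range _
  choose y hy using h
  refine ⟨D.range.index, ∑ i, (AddMonoidHom.mk' (fun z : Fin k → ℤ => z i • y i)
    (fun a b => by simp [add_smul])), Nat.pos_of_ne_zero hD.index_ne_zero, fun z => ?_⟩
  simp only [AddMonoidHom.finsetSum_apply, AddMonoidHom.mk'_apply, map_sum, map_zsmul, hy]
  conv_rhs => rw [← Finset.univ_sum_single z, Finset.smul_sum]
  refine Finset.sum_congr rfl fun i _ => ?_
  ext j
  by_cases hij : j = i
  · subst hij; simp [mul_comm]
  · simp [hij]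

theorem injective_of_finiteIndex_range (D : (Fin k → ℤ) →+ (Fin k → ℤ))
    (hD : D.range.FiniteIndex) : Function.Injective D := by
  obtain ⟨n, E, hn, hE⟩ := exists_right_quasi_inverse D hD
  have h1 : LinearMap.toMatrix' D.toIntLinearMap * LinearMap.toMatrix' E.toIntLinearMap =
      (n : ℤ) • 1 := by
    rw [← LinearMap.toMatrix'_comp, ← LinearMap.toMatrix'_one, ← map_smul]
    congr 1
    apply LinearMap.ext
    intro z
    simpa using hE z
  have h2 := congrArg Matrix.det h1
  rw [Matrix.det_mul, Matrix.det_smul, Matrix.det_one, mul_one] at h2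
  have h3 : (LinearMap.toMatrix' D.toIntLinearMap).det ≠ 0 := by
    intro h0
    rw [h0, zero_mul] at h2
    exact pow_ne_zero _ (by exact_mod_cast hn.ne') h2.symm
  rw [injective_iff_map_eq_zero]
  intro x hx
  refine Matrix.eq_zero_of_mulVec_eq_zero h3 ?_
  rw [LinearMap.toMatrix'_mulVec]
  exact hx

/-- The affine permutation `z ↦ M z + v`. -/
def affinePerm (v : Fin k → ℤ) : Equiv.Perm (Fin k → ℤ) := M.toEquiv.trans (Equiv.addRight v)

theorem affinePerm_apply (v z : Fin k → ℤ) : affinePerm M v z = M z + v := rfl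

/-- The powers of an additive automorphism. -/
def iter (j : ℤ) : (Fin k → ℤ) ≃+ (Fin k → ℤ) := j • (show AddAut (Fin k → ℤ) from M)

theorem iter_add_apply (i j : ℤ) (z : Fin k → ℤ) : iter M (i + j) z = iter M i (iter M j z) :=
  DFunLike.congr_fun (add_zsmul (show AddAut (Fin k → ℤ) from M) i j) z

theorem iter_one : iter M 1 = M := one_zsmul (show AddAut (Fin k → ℤ) from M)

/-- The map `z ↦ (1 - M) z - v` linearizes the affine permutation: it intertwines it with `M`, even
when no fixed point exists to serve as origin. -/
theorem affinePerm_zpow (v z : Fin k → ℤ) (j : ℤ) :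
    oneSub M.toAddMonoidHom ((affinePerm M v ^ j) z) - v =
      iter M j (oneSub M.toAddMonoidHom z - v) := by
  have h1 : ∀ z, oneSub M.toAddMonoidHom (affinePerm M v z) - v =
      M (oneSub M.toAddMonoidHom z - v) := by
    intro z
    simp [affinePerm_apply]
    abel
  induction j using Int.induction_on generalizing z with
  | zero => simp [iter]
  | succ j ih =>
    rw [zpow_add, zpow_one, Equiv.Perm.mul_apply, ih, h1, iter_add_apply, iter_one]
  | pred j ih =>
    obtain ⟨y, rfl⟩ := (affinePerm M v).surjective z
    rw [zpow_sub, zpow_one, Equiv.Perm.mul_apply, Equiv.Perm.inv_def,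
      Equiv.symm_apply_apply, ih, h1]
    conv_lhs => rw [← sub_add_cancel (-(j : ℤ)) 1, iter_add_apply, iter_one]

/-- The orbit structure of a lattice affine permutation without eigenvalue one. -/
theorem exists_orbit_representatives (hM : (oneSub M.toAddMonoidHom).range.FiniteIndex)
    (v w : Fin k → ℤ) (hw : affinePerm M v w ≠ w) :
    ∃ u : ℕ → Fin k → ℤ, (∀ s t (j : ℤ), (affinePerm M v ^ j) (u s) = u t → s = t) ∧
      ∀ t (j : ℤ), (affinePerm M v ^ j) (u t) = u t → (affinePerm M v ^ j) w = w := by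
  set D := oneSub M.toAddMonoidHom
  have hinj := injective_of_finiteIndex_range D hM
  obtain ⟨n, E, hn, hE⟩ := exists_right_quasi_inverse D hM
  have hx : D w - v ≠ 0 := by
    intro h
    apply hw
    rw [affinePerm_apply]
    have : w - M w - v = 0 := h
    rw [sub_sub, sub_eq_zero] at this
    exact this.symm
  have hu : ∀ t : ℕ, D (w + t • E (D w - v)) - v = (1 + t * n) • (D w - v) := by
    intro t
    rw [map_add, map_nsmul, hE, add_smul, one_smul, mul_smul]
    abel
  -- In the linearized picture these are the multiples `(1 + t * n) x` of `x = D w - v ≠ 0`. Their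
  -- contents differ, which separates orbits, and cancelling the factor turns a period of `u t` into
  -- one of `w`.
  refine ⟨fun t => w + t • E (D w - v), fun s t j h => ?_, fun t j h => ?_⟩
  · have h1 := affinePerm_zpow M v (w + s • E (D w - v)) j
    change D _ - v = iter M j (D _ - v) at h1
    rw [h, hu, hu, map_nsmul] at h1
    have := eq_of_nsmul_eq_nsmul_map _ hx h1
    have h2 : t * n = s * n := by omega
    exact (Nat.eq_of_mul_eq_mul_right hn h2).symm
  · have h1 := affinePerm_zpow M v (w + t • E (D w - v)) j
    change D _ - v = iter M j (D _ - v) at h1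
    rw [h, hu, map_nsmul] at h1
    have h2 := smul_right_injective _ (show 1 + t * n ≠ 0 by omega) h1
    have h3 := affinePerm_zpow M v w j
    change D _ - v = iter M j (D _ - v) at h3
    rw [← h2] at h3
    exact hinj (sub_left_injective h3)

theorem exists_affinePerm_ne (hk : 1 ≤ k) (hM : (oneSub M.toAddMonoidHom).range.FiniteIndex)
    (v : Fin k → ℤ) : ∃ w, affinePerm M v w ≠ w := by
  by_contra! h
  have h0 := h 0
  have h1 := h (Pi.single ⟨0, hk⟩ 1)
  rw [affinePerm_apply, map_zero, zero_add] at h0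
  rw [affinePerm_apply, h0, add_zero] at h1
  have h2 : oneSub M.toAddMonoidHom (Pi.single ⟨0, hk⟩ 1) = oneSub M.toAddMonoidHom 0 := by
    simp [h1]
  have h3 := injective_of_finiteIndex_range _ hM h2
  simp at h3

/-- If every point had an odd period, a common odd period of `0` and the basis vectors would be an
exponent killing `M`, so `M` would have eigenvalue one. -/
theorem exists_no_odd_period (hk : Odd k) (hM : (oneSub M.toAddMonoidHom).range.FiniteIndex)
    (v : Fin k → ℤ) : ∃ w, ∀ j : ℤ, (affinePerm M v ^ j) w = w → Even j := by
  by_contra! h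
  have hnat : ∀ w, ∃ l : ℕ, Odd l ∧ (affinePerm M v ^ l) w = w := by
    intro w
    obtain ⟨j, hj, hodd⟩ := h w
    refine ⟨j.natAbs, by simpa using hodd, ?_⟩
    rcases Int.natAbs_eq j with h1 | h1
    · rw [h1, zpow_natCast] at hj; exact hj
    · rw [h1, zpow_neg, zpow_natCast, Equiv.Perm.inv_eq_iff_eq] at hj; exact hj.symm
  choose l hl hlw using hnat
  let L := l 0 * ∏ i : Fin k, l (Pi.single i 1)
  have hL : Odd L := (hl 0).mul (by
    exact Finset.prod_induction _ Odd (fun _ _ => Odd.mul) odd_one (fun i _ => hl _))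
  have hper : ∀ w, l w ∣ L → (affinePerm M v ^ L) w = w := by
    rintro w ⟨m, hm⟩
    rw [hm, pow_mul]
    exact Function.IsFixedPt.perm_pow (hlw w) m
  have hinj := injective_of_finiteIndex_range _ hM
  set D := oneSub M.toAddMonoidHom
  have key : ∀ w, l w ∣ L → iter M L (D w - v) = D w - v := by
    intro w hw
    have := affinePerm_zpow M v w L
    rw [zpow_natCast, hper w hw] at this
    exact this.symm
  have h0 : iter M L v = v := by
    have := key 0 (Dvd.intro _ rfl)
    rw [map_zero, zero_sub, map_neg] at this
    exact neg_injective this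
  have hcomm : ∀ z, iter M L (D z) = D (iter M L z) := by
    intro z
    have : iter M L (M z) = M (iter M L z) := by
      have h1 := iter_add_apply M L 1 z
      rw [add_comm, iter_add_apply, iter_one] at h1
      exact h1.symm
    simp [D, this]
  have hid : ∀ i, iter M L (Pi.single i 1) = Pi.single i 1 := by
    intro i
    have := key (Pi.single i 1)
      ((Finset.dvd_prod_of_mem (fun i => l (Pi.single i 1)) (Finset.mem_univ i)).mul_left _)
    rw [map_sub, h0, hcomm] at this
    exact hinj (sub_left_injective this)
  have hpow : ∀ (n : ℕ) z, ((LinearMap.toMatrix' M.toAddMonoidHom.toIntLinearMap) ^ n).mulVec z =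
      iter M n z := by
    intro n
    induction n with
    | zero => intro z; simp [iter]
    | succ n ih =>
      intro z
      rw [pow_succ, ← Matrix.mulVec_mulVec, ih, LinearMap.toMatrix'_mulVec]
      simp only [iter, natCast_zsmul, succ_nsmul]
      rfl
  have hmat : (LinearMap.toMatrix' M.toAddMonoidHom.toIntLinearMap) ^ L = 1 := by
    apply Matrix.ext_of_mulVec_single
    intro i
    rw [hpow, hid, Matrix.one_mulVec]
  have hdet := det_one_sub_eq_zero_of_odd_pow hk hL _ hmat
  obtain ⟨x, hx, hx0⟩ := Matrix.exists_mulVec_eq_zero_iff.2 hdet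
  apply hx
  rw [Matrix.sub_mulVec, Matrix.one_mulVec, LinearMap.toMatrix'_mulVec] at hx0
  apply hinj
  rw [map_zero]
  exact hx0

end Lattice

/-- Put `c ^ j` at `T ^ j w` and `0` off the orbit; the hypothesis on periods is exactly
well-definedness. -/
theorem exists_twisted_invariant {X R : Type*} [CommRing R] (T : Equiv.Perm X) (c : Rˣ) (w : X)
    (h : ∀ j : ℤ, (T ^ j) w = w → c ^ j = 1) :
    ∃ χ : X → R, (∀ z, χ (T z) = c * χ z) ∧ χ w = 1 ∧ ∀ z, (∀ j : ℤ, (T ^ j) w ≠ z) → χ z = 0 := by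
  classical
  let χ : X → R := fun z => if hz : ∃ j : ℤ, (T ^ j) w = z then ((c ^ hz.choose : Rˣ) : R) else 0
  have hχ : ∀ j : ℤ, χ ((T ^ j) w) = ((c ^ j : Rˣ) : R) := by
    intro j
    have hz : ∃ i : ℤ, (T ^ i) w = (T ^ j) w := ⟨j, rfl⟩
    simp only [χ, dif_pos hz]
    have h1 := hz.choose_spec
    have h2 : c ^ (hz.choose - j) = 1 := by
      apply h
      rw [sub_eq_neg_add, zpow_add, Equiv.Perm.mul_apply, h1, ← Equiv.Perm.mul_apply, ← zpow_add,
        neg_add_cancel, zpow_zero, Equiv.Perm.one_apply]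
    rw [zpow_sub, mul_inv_eq_one] at h2
    rw [h2]
  refine ⟨χ, fun z => ?_, by simpa using hχ 0, fun z hz => dif_neg (by simpa using hz)⟩
  by_cases hz : ∃ j : ℤ, (T ^ j) w = z
  · obtain ⟨j, rfl⟩ := hz
    have : T ((T ^ j) w) = (T ^ (1 + j)) w := by rw [zpow_add, zpow_one, Equiv.Perm.mul_apply]
    rw [this, hχ, hχ, zpow_add, zpow_one, Units.val_mul]
  · have h1 : χ z = 0 := dif_neg hz
    have h2 : χ (T z) = 0 := by
      apply dif_neg
      rintro ⟨j, hj⟩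
      apply hz
      refine ⟨-1 + j, ?_⟩
      rw [zpow_add, Equiv.Perm.mul_apply, hj]
      simp
    rw [h1, h2, mul_zero]

/-! ### Passing finiteness of the cokernel of `1 - f` to invariant subgroups. -/

theorem card_ker_oneSub_eq_index {Q : Type*} [AddCommGroup Q] [Finite Q] (D : Q →+ Q) :
    Nat.card D.ker = D.range.index := by
  have h1 := D.ker.card_mul_index
  rw [AddSubgroup.index_ker] at h1
  have h2 := D.range.card_mul_index
  rw [← h1, mul_comm] at h2
  exact (Nat.eq_of_mul_eq_mul_right Nat.card_pos h2).symm

/-- A group endomorphism `f` of an abelian group whose twisted cokernel is finite has finitely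
many fixed points modulo an invariant subgroup `B` that is an intersection of invariant subgroups
of finite index. -/
theorem relIndex_comap_oneSub_ne_zero {A : Type*} [AddCommGroup A] (f : A →+ A)
    (hf : (oneSub f).range.FiniteIndex) (B : AddSubgroup A)
    (hB : ∀ a ∉ B, ∃ N : AddSubgroup A, B ≤ N ∧ N.FiniteIndex ∧ N ≤ N.comap f ∧ a ∉ N) :
    B.relIndex (B.comap (oneSub f)) ≠ 0 := by
  intro h0
  have hinf : Infinite (↥(B.comap (oneSub f)) ⧸ B.addSubgroupOf (B.comap (oneSub f))) := by
    rw [AddSubgroup.relIndex, AddSubgroup.index, Nat.card_eq_zero] at h0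
    exact h0.resolve_left fun h => h.elim' (QuotientAddGroup.mk 0)
  set n := (oneSub f).range.index
  -- One class more than the cokernel of `1 - f` has elements. All of them stay distinct in a finite
  -- quotient `A ⧸ K`, where fixed points are exactly as numerous as the cokernel.
  obtain ⟨s, hs⟩ := Infinite.exists_subset_card_eq
    (↥(B.comap (oneSub f)) ⧸ B.addSubgroupOf (B.comap (oneSub f))) (n + 1)
  let a : s → A := fun x => (Quotient.out x.1 : ↥(B.comap (oneSub f)))
  have ha : ∀ x, oneSub f (a x) ∈ B := fun x => (Quotient.out x.1).2
  have hne : ∀ x y, x ≠ y → a x - a y ∉ B := by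
    intro x y hxy hmem
    apply hxy
    rw [Subtype.ext_iff, ← QuotientAddGroup.out_eq' x.1, ← QuotientAddGroup.out_eq' y.1, eq_comm,
      QuotientAddGroup.eq, AddSubgroup.mem_addSubgroupOf]
    rw [sub_eq_neg_add] at hmem
    exact hmem
  have hex : ∀ x y, ∃ N : AddSubgroup A, B ≤ N ∧ N.FiniteIndex ∧ N ≤ N.comap f ∧
      (x ≠ y → a x - a y ∉ N) := by
    intro x y
    by_cases hxy : x = y
    · exact ⟨⊤, le_top, inferInstance, le_rfl, fun h => (h hxy).elim⟩
    · obtain ⟨N, h1, h2, h3, h4⟩ := hB _ (hne x y hxy)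
      exact ⟨N, h1, h2, h3, fun _ => h4⟩
  choose N hBN hNfin hNf haN using hex
  let K : AddSubgroup A := ⨅ x, ⨅ y, N x y
  have hKfin : K.FiniteIndex := by
    refine ⟨AddSubgroup.index_iInf_ne_zero fun x => AddSubgroup.index_iInf_ne_zero fun y => ?_⟩
    exact (hNfin x y).index_ne_zero
  have hBK : B ≤ K := le_iInf fun x => le_iInf fun y => hBN x y
  have hKN : ∀ x y, K ≤ N x y := fun x y => (iInf_le _ x).trans (iInf_le _ y)
  have hKf : K ≤ K.comap f := by
    intro z hz
    simp only [K, AddSubgroup.mem_comap, AddSubgroup.mem_iInf]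
    exact fun x y => hNf x y (hKN x y hz)
  have : Finite (A ⧸ K) := AddSubgroup.finite_quotient_of_finiteIndex
  let g : A ⧸ K →+ A ⧸ K := QuotientAddGroup.map K K f hKf
  have hcomp : ∀ z : A, oneSub g (QuotientAddGroup.mk z) = QuotientAddGroup.mk (oneSub f z) := by
    intro z
    rfl
  have hindex : (oneSub g).range.index ≤ n := by
    have h1 : (oneSub f).range.map (QuotientAddGroup.mk' K) ≤ (oneSub g).range := by
      rintro _ ⟨_, ⟨z, rfl⟩, rfl⟩
      exact ⟨QuotientAddGroup.mk z, hcomp z⟩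
    have h2 := AddSubgroup.index_map_dvd (H := (oneSub f).range)
      (f := QuotientAddGroup.mk' K) (QuotientAddGroup.mk'_surjective K)
    have h3 := AddSubgroup.index_dvd_of_le h1
    exact Nat.le_of_dvd (Nat.pos_of_ne_zero hf.index_ne_zero) (h3.trans h2)
  let b : s → (oneSub g).ker := fun x => ⟨QuotientAddGroup.mk (a x), by
    rw [AddMonoidHom.mem_ker, hcomp]
    exact (QuotientAddGroup.eq_zero_iff _).2 (hBK (ha x))⟩
  have hb : Function.Injective b := by
    intro x y hxy
    by_contra hne'
    apply haN x y hne'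
    apply hKN x y
    have h1 : (QuotientAddGroup.mk (a x) : A ⧸ K) = QuotientAddGroup.mk (a y) :=
      congrArg Subtype.val hxy
    rw [eq_comm, QuotientAddGroup.eq] at h1
    rwa [sub_eq_neg_add]
  have h1 := Nat.card_le_card_of_injective b hb
  rw [card_ker_oneSub_eq_index, Nat.card_eq_fintype_card, Fintype.card_coe, hs] at h1
  omega

/-- With `D = 1 - f`, use `D B ≤ D A ⊓ B ≤ B`: the lower step is a quotient of `D⁻¹ B / B`, the
fixed points on `A / B`; the upper step embeds in `A / D A`. -/
theorem relIndex_map_oneSub_ne_zero {A : Type*} [AddCommGroup A] (f : A →+ A)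
    (hf : (oneSub f).range.FiniteIndex) (B : AddSubgroup A)
    (hB : ∀ a ∉ B, ∃ N : AddSubgroup A, B ≤ N ∧ N.FiniteIndex ∧ N ≤ N.comap f ∧ a ∉ N) :
    (B.map (oneSub f)).relIndex B ≠ 0 := by
  refine AddSubgroup.relIndex_ne_zero_trans (K := (oneSub f).range ⊓ B) ?_ ?_
  · rw [← AddSubgroup.map_comap_eq, AddSubgroup.relIndex_map_map]
    refine mt (fun h => ?_) (relIndex_comap_oneSub_ne_zero f hf B hB)
    have hker : (oneSub f).ker ≤ B.comap (oneSub f) := (oneSub f).ker_le_comap B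
    rw [sup_eq_left.2 hker] at h
    exact AddSubgroup.relIndex_eq_zero_of_le_left le_sup_left h
  · rw [AddSubgroup.inf_relIndex_right]
    have := AddSubgroup.relIndex_dvd_index_of_normal (oneSub f).range B
    intro h
    rw [h, zero_dvd_iff] at this
    exact hf.index_ne_zero this

theorem exists_ne_sub_mem_of_relIndex_ne_zero {A : Type*} [AddCommGroup A] {C B : AddSubgroup A}
    (h : C.relIndex B ≠ 0) (b : ℕ → A) (hb : ∀ n, b n ∈ B) : ∃ s t, s ≠ t ∧ b s - b t ∈ C := by
  have : (C.addSubgroupOf B).FiniteIndex := ⟨h⟩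
  have : Finite (B ⧸ C.addSubgroupOf B) := AddSubgroup.finite_quotient_of_finiteIndex
  obtain ⟨s, t, hst, he⟩ := Finite.exists_ne_map_eq_of_infinite
    (fun n : ℕ => (QuotientAddGroup.mk ⟨b n, hb n⟩ : B ⧸ C.addSubgroupOf B))
  refine ⟨t, s, hst.symm, ?_⟩
  rw [QuotientAddGroup.eq, AddSubgroup.mem_addSubgroupOf] at he
  rw [sub_eq_neg_add]
  exact he

/-! ### The Ulm quotient attached to the summand of multiplicity one. -/

section Ulm

/-- The subgroup `A[n] + pA` of an abelian group. -/
def torsionSup (A : Type*) [AddCommGroup A] (p n : ℕ) : AddSubgroup A where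
  carrier := {x | ∃ a b, x = a + p • b ∧ n • a = 0}
  zero_mem' := ⟨0, 0, by simp⟩
  add_mem' := by
    rintro _ _ ⟨a, b, rfl, ha⟩ ⟨a', b', rfl, ha'⟩
    exact ⟨a + a', b + b', by simp; abel, by simp [ha, ha']⟩
  neg_mem' := by
    rintro _ ⟨a, b, rfl, ha⟩
    exact ⟨-a, -b, by simp; abel, by simp [ha]⟩

theorem map_mem_torsionSup {A A' : Type*} [AddCommGroup A] [AddCommGroup A'] (f : A →+ A')
    {p n : ℕ} {x : A} (hx : x ∈ torsionSup A p n) : f x ∈ torsionSup A' p n := by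
  obtain ⟨a, b, rfl, ha⟩ := hx
  exact ⟨f a, f b, by simp, by rw [← map_nsmul, ha, map_zero]⟩

theorem mem_torsionSup_finsupp {V G : Type*} [AddCommGroup G] {p n : ℕ} {f : V →₀ G} :
    f ∈ torsionSup (V →₀ G) p n ↔ ∀ x, f x ∈ torsionSup G p n := by
  refine ⟨fun h x => map_mem_torsionSup (Finsupp.applyAddHom x) h, fun h => ?_⟩
  rw [← Finsupp.sum_single f]
  exact sum_mem fun x _ => map_mem_torsionSup (Finsupp.singleAddHom x) (h x)

/-- Other summands do not contribute: for `q ≠ p` there is no `p`-torsion, for `r ≤ s` everything is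
killed by `p ^ s`, and for `r > s + 1` the `p ^ (s + 1)`-torsion is divisible by `p`. -/
theorem zmod_mem_torsionSup_of_ne {p q s r : ℕ} (hp : p.Prime) (hq : q.Prime)
    (h : ¬ (q = p ∧ r = s + 1)) (a : ZMod (q ^ r)) (ha : p ^ (s + 1) • a = 0) :
    a ∈ torsionSup (ZMod (q ^ r)) p (p ^ s) := by
  by_cases hqp : q = p
  · subst hqp
    rcases lt_or_ge s r with hlt | hge
    · have hr : s + 1 < r := by
        rcases lt_or_eq_of_le (Nat.succ_le_of_lt hlt) with h1 | h1
        · exact h1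
        · exact (h ⟨rfl, h1.symm⟩).elim
      have : NeZero (q ^ r) := ⟨pow_ne_zero _ hq.ne_zero⟩
      rw [← ZMod.natCast_zmod_val a, nsmul_eq_mul, ← Nat.cast_mul,
        ZMod.natCast_eq_zero_iff] at ha
      have h1 : q ^ (s + 1) * q ∣ q ^ (s + 1) * a.val := by
        rw [← pow_succ]
        exact (pow_dvd_pow q hr).trans ha
      obtain ⟨b, hb⟩ := Nat.dvd_of_mul_dvd_mul_left (pow_pos hq.pos _) h1
      refine ⟨0, b, ?_, by simp⟩
      rw [zero_add, nsmul_eq_mul, ← Nat.cast_mul, ← hb, ZMod.natCast_zmod_val]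
    · refine ⟨a, 0, by simp, ?_⟩
      rw [nsmul_eq_mul, (ZMod.natCast_eq_zero_iff _ _).2 (pow_dvd_pow q hge), zero_mul]
  · have hu : IsUnit ((p ^ (s + 1) : ℕ) : ZMod (q ^ r)) := by
      rw [ZMod.isUnit_iff_coprime]
      exact Nat.Coprime.pow _ _ ((Nat.coprime_primes hp hq).2 (Ne.symm hqp))
    rw [nsmul_eq_mul, hu.mul_right_eq_zero] at ha
    rw [ha]
    exact zero_mem _

/-- A direct summand `ℤ/p^(s+1)` of multiplicity one yields a one-dimensional Ulm quotient. -/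
theorem exists_ulm_character {G : Type*} [AddCommGroup G] {ι : Type*} [Fintype ι]
    (p r d : ι → ℕ) (hp : ∀ j, (p j).Prime)
    (hinj : Function.Injective (fun j => (p j, r j)))
    (e : G ≃+ ⨁ j, (Fin (d j) → ZMod (p j ^ r j))) (j₀ : ι) (hd : d j₀ = 1) (s : ℕ)
    (hs : r j₀ = s + 1) :
    ∃ (π : G →+ ZMod (p j₀)) (γ : G), γ ∈ torsionSup G (p j₀) (p j₀ ^ (s + 1)) ∧ π γ = 1 ∧
      ∀ g ∈ torsionSup G (p j₀) (p j₀ ^ (s + 1)),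
        (π g = 0 ↔ g ∈ torsionSup G (p j₀) (p j₀ ^ s)) := by
  classical
  have hdvd : p j₀ ∣ p j₀ ^ r j₀ := dvd_pow_self _ (by omega)
  have : NeZero (p j₀ ^ r j₀) := ⟨pow_ne_zero _ (hp j₀).ne_zero⟩
  let i₀ : Fin (d j₀) := ⟨0, by omega⟩
  have hi₀ : ∀ i : Fin (d j₀), i = i₀ := fun i => Fin.ext (by have := i.2; simp [i₀]; omega)
  let coord : ∀ j, Fin (d j) → G →+ ZMod (p j ^ r j) := fun j i =>
    (Pi.evalAddMonoidHom (fun _ : Fin (d j) => ZMod (p j ^ r j)) i).comp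
      ((DFinsupp.evalAddMonoidHom j).comp e.toAddMonoidHom)
  let incl : ∀ j, Fin (d j) → ZMod (p j ^ r j) →+ G := fun j i =>
    e.symm.toAddMonoidHom.comp ((DirectSum.of (fun j => Fin (d j) → ZMod (p j ^ r j)) j).comp
      (AddMonoidHom.single (fun _ : Fin (d j) => ZMod (p j ^ r j)) i))
  have hrec : ∀ g, g = ∑ j, ∑ i, incl j i (coord j i g) := by
    intro g
    apply e.injective
    simp only [map_sum, incl, coord, AddMonoidHom.comp_apply,
      AddEquiv.toAddMonoidHom_eq_coe, AddMonoidHom.coe_coe, AddEquiv.apply_symm_apply]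
    conv_lhs => rw [← DirectSum.sum_univ_of (e g)]
    refine Finset.sum_congr rfl fun j _ => ?_
    rw [← map_sum]
    congr 1
    exact (Finset.univ_sum_single (e g j)).symm
  let π : G →+ ZMod (p j₀) := (ZMod.castHom hdvd (ZMod (p j₀))).toAddMonoidHom.comp (coord j₀ i₀)
  have hπ : ∀ g, π g = ZMod.castHom hdvd (ZMod (p j₀)) (coord j₀ i₀ g) := fun _ => rfl
  have hci : ∀ a, coord j₀ i₀ (incl j₀ i₀ a) = a := by
    intro a
    simp only [incl, coord, AddMonoidHom.comp_apply,
      AddEquiv.toAddMonoidHom_eq_coe, AddMonoidHom.coe_coe, AddEquiv.apply_symm_apply]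
    change (DirectSum.of (fun j => Fin (d j) → ZMod (p j ^ r j)) j₀ _) j₀ i₀ = a
    rw [DirectSum.of_eq_same]
    simp
  have hcast : ∀ a : ZMod (p j₀ ^ r j₀), ZMod.castHom hdvd (ZMod (p j₀)) a = 0 →
      ∃ b, a = p j₀ • b := by
    intro a ha
    rw [← ZMod.natCast_zmod_val a, map_natCast, ZMod.natCast_eq_zero_iff] at ha
    obtain ⟨b, hb⟩ := ha
    exact ⟨b, by rw [nsmul_eq_mul, ← Nat.cast_mul, ← hb, ZMod.natCast_zmod_val]⟩
  have hπp : ∀ b, π (p j₀ • b) = 0 := by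
    intro b
    rw [map_nsmul, nsmul_eq_mul, ZMod.natCast_self, zero_mul]
  refine ⟨π, incl j₀ i₀ 1, ⟨incl j₀ i₀ 1, 0, by simp, ?_⟩, ?_, ?_⟩
  · rw [← hs, ← map_nsmul, nsmul_eq_mul, ZMod.natCast_self, zero_mul, map_zero]
  · rw [hπ, hci, map_one]
  · rintro _ ⟨a, b, rfl, ha⟩
    have hb : p j₀ • b ∈ torsionSup G (p j₀) (p j₀ ^ s) := ⟨0, b, by simp, by simp⟩
    rw [map_add, hπp, add_zero, AddSubgroup.add_mem_cancel_right _ hb]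
    constructor
    · intro h0
      rw [hrec a]
      refine sum_mem fun j _ => sum_mem fun i _ => map_mem_torsionSup _ ?_
      by_cases hj : p j = p j₀ ∧ r j = s + 1
      · have : j = j₀ := hinj (Prod.ext hj.1 (hj.2.trans hs.symm))
        subst this
        rw [hi₀ i]
        obtain ⟨c, hc⟩ := hcast _ h0
        exact ⟨0, c, by rw [hc, zero_add], by simp⟩
      · refine zmod_mem_torsionSup_of_ne (hp j₀) (hp j) hj _ ?_
        rw [← map_nsmul, ha, map_zero]
    · rintro ⟨a', b', rfl, ha'⟩
      rw [map_add, hπp, add_zero, hπ]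
      have h1 : p j₀ ^ s • coord j₀ i₀ a' = 0 := by rw [← map_nsmul, ha', map_zero]
      generalize coord j₀ i₀ a' = y at h1
      rw [← ZMod.natCast_zmod_val y, nsmul_eq_mul, ← Nat.cast_mul, ZMod.natCast_eq_zero_iff] at h1
      have h2 : p j₀ ∣ y.val := by
        refine Nat.dvd_of_mul_dvd_mul_left (pow_pos (hp j₀).pos s) (Dvd.dvd.trans ?_ h1)
        rw [hs, pow_succ]
      rw [← ZMod.natCast_zmod_val y, map_natCast, ZMod.natCast_eq_zero_iff]
      exact h2

end Ulm

/-- Unless both supports are singletons, two different pairs give unique sums. Neither coefficient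
can cancel, so both sums are `0`, contradicting uniqueness. -/
theorem eq_single_of_mul_eq_one {R V : Type*} [CommRing R] [IsDomain R] [AddCommGroup V]
    [TwoUniqueSums V] {u w : AddMonoidAlgebra R V} (h : u * w = 1) :
    ∃ v c, u = AddMonoidAlgebra.single v c := by
  classical
  have hu : u ≠ 0 := left_ne_zero_of_mul_eq_one h
  have hw : w ≠ 0 := right_ne_zero_of_mul_eq_one h
  have hone : ∀ x : V, (1 : AddMonoidAlgebra R V).coeff x ≠ 0 → x = 0 := by
    intro x hx
    by_contra hne
    apply hx
    rw [AddMonoidAlgebra.one_def, AddMonoidAlgebra.coeff_single, Finsupp.single_apply,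
      if_neg (Ne.symm hne)]
  have hcard : ¬ 1 < u.coeff.support.card * w.coeff.support.card := by
    intro hlt
    obtain ⟨⟨a, b⟩, hab, ⟨a', b'⟩, hab', hne, h1, h2⟩ := TwoUniqueSums.uniqueAdd_of_one_lt_card hlt
    rw [Finset.mem_product, Finsupp.mem_support_iff, Finsupp.mem_support_iff] at hab hab'
    have h3 := AddMonoidAlgebra.coeff_mul_add_of_uniqueAdd h1
    have h4 := AddMonoidAlgebra.coeff_mul_add_of_uniqueAdd h2
    rw [h] at h3 h4
    have h5 := hone _ (h3 ▸ mul_ne_zero hab.1 hab.2)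
    have h6 := hone _ (h4 ▸ mul_ne_zero hab'.1 hab'.2)
    have h7 := h1 (Finsupp.mem_support_iff.2 hab'.1) (Finsupp.mem_support_iff.2 hab'.2)
      (h6.trans h5.symm)
    exact hne (Prod.ext h7.1.symm h7.2.symm)
  have hwc : 0 < w.coeff.support.card := by
    rw [Finset.card_pos, Finsupp.support_nonempty_iff]
    simpa using hw
  have huc : u.coeff.support.card ≤ 1 := by
    by_contra hlt
    push Not at hlt hcard
    nlinarith
  obtain ⟨v, hv⟩ | h0 := Nat.le_one_iff_eq_zero_or_eq_one.1 huc |>.symm.imp_left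
    Finset.card_eq_one.1
  · obtain ⟨c, -, hc⟩ := Finsupp.support_eq_singleton.1 hv |> fun h => (⟨_, h.1, h.2⟩ :
      ∃ c, c ≠ 0 ∧ u.coeff = Finsupp.single v c)
    exact ⟨v, c, AddMonoidAlgebra.ext (by rw [hc, AddMonoidAlgebra.coeff_single])⟩
  · rw [Finset.card_eq_zero, Finsupp.support_eq_empty, AddMonoidAlgebra.coeff_eq_zero] at h0
    exact (hu h0).elim

/-! ### Semilinear maps and separation by reducing the lattice modulo `m`. -/

/-- An additive endomorphism of `⊕_V G` that is semilinear over an endomorphism `M` of `V`. -/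
def IsSemilinear {G V : Type*} [AddCommGroup G] [AddCommGroup V] (M : V →+ V)
    (f : (V →₀ G) →+ (V →₀ G)) : Prop :=
  ∀ y g, f (Finsupp.single y g) = (f (Finsupp.single 0 g)).mapDomain (M y + ·)

/-- Reduction of an integral lattice modulo `m`. -/
def latticeMod (k m : ℕ) : (Fin k → ℤ) →+ (Fin k → ZMod m) :=
  (Int.castAddHom (ZMod m)).compLeft (Fin k)

theorem latticeMod_surjective (k m : ℕ) : Function.Surjective (latticeMod k m) := by
  intro z
  choose y hy using fun i => ZMod.intCast_surjective (z i)
  exact ⟨y, funext hy⟩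

theorem exists_smul_of_latticeMod_eq_zero {k m : ℕ} {x : Fin k → ℤ} (h : latticeMod k m x = 0) :
    ∃ y, x = m • y := by
  have h1 : ∀ i, ∃ y, x i = m * y := fun i =>
    (ZMod.intCast_zmod_eq_zero_iff_dvd (x i) m).1 (congrFun h i)
  choose y hy using h1
  exact ⟨y, funext fun i => by simpa using hy i⟩

theorem exists_latticeMod_injOn {k : ℕ} (S : Finset (Fin k → ℤ)) (x₀ : Fin k → ℤ) :
    ∃ m, 0 < m ∧ ∀ x ∈ S, latticeMod k m x = latticeMod k m x₀ → x = x₀ := by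
  refine ⟨1 + ∑ x ∈ S, ∑ i, (x i - x₀ i).natAbs, by omega, fun x hx h => ?_⟩
  rw [← sub_eq_zero, ← map_sub] at h
  obtain ⟨y, hy⟩ := exists_smul_of_latticeMod_eq_zero h
  ext i
  rw [← sub_eq_zero]
  have h1 : x i - x₀ i = (1 + ∑ x ∈ S, ∑ i, (x i - x₀ i).natAbs : ℕ) * y i := by
    have := congrFun hy i
    rwa [Pi.smul_apply, Pi.sub_apply, nsmul_eq_mul] at this
  refine Int.eq_zero_of_abs_lt_dvd ⟨y i, h1⟩ ?_
  rw [Int.abs_eq_natAbs, Nat.cast_lt]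
  have h2 : (x i - x₀ i).natAbs ≤ ∑ i, (x i - x₀ i).natAbs :=
    Finset.single_le_sum (f := fun i => (x i - x₀ i).natAbs) (fun _ _ => Nat.zero_le _)
      (Finset.mem_univ i)
  have h3 : ∑ i, (x i - x₀ i).natAbs ≤ ∑ x ∈ S, ∑ i, (x i - x₀ i).natAbs :=
    Finset.single_le_sum (f := fun x : Fin k → ℤ => ∑ i, (x i - x₀ i).natAbs)
      (fun _ _ => Nat.zero_le _) hx
  omega

/-- Invariant subgroups of the form `⊕ H` are separated by invariant subgroups of finite index. -/
theorem exists_invariant_finiteIndex {G : Type*} [AddCommGroup G] [Finite G] {k : ℕ}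
    (M : (Fin k → ℤ) →+ (Fin k → ℤ)) (f : ((Fin k → ℤ) →₀ G) →+ ((Fin k → ℤ) →₀ G))
    (hf : IsSemilinear M f) (H : AddSubgroup G) (B : AddSubgroup ((Fin k → ℤ) →₀ G))
    (hBH : ∀ z, z ∈ B ↔ ∀ x, z x ∈ H) (hBf : B ≤ B.comap f) (a : (Fin k → ℤ) →₀ G)
    (ha : a ∉ B) :
    ∃ N : AddSubgroup ((Fin k → ℤ) →₀ G), B ≤ N ∧ N.FiniteIndex ∧ N ≤ N.comap f ∧ a ∉ N := by
  classical
  rw [hBH] at ha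
  push Not at ha
  obtain ⟨x₀, hx₀⟩ := ha
  obtain ⟨m, hm, hmS⟩ := exists_latticeMod_injOn a.support x₀
  have : NeZero m := ⟨hm.ne'⟩
  let q : ((Fin k → ℤ) →₀ G) →+ ((Fin k → ZMod m) →₀ G) :=
    Finsupp.mapDomain.addMonoidHom (latticeMod k m)
  have hq : ∀ z, q z = z.mapDomain (latticeMod k m) := fun _ => rfl
  have hqapply : ∀ z y, q z y = z.sum fun x g => if latticeMod k m x = y then g else 0 := by
    intro z y
    rw [hq, Finsupp.mapDomain, Finsupp.sum_apply]
    simp only [Finsupp.single_apply]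
  let lift := Function.surjInv (latticeMod_surjective k m)
  let F : ((Fin k → ZMod m) →₀ G) →+ ((Fin k → ZMod m) →₀ G) :=
    Finsupp.liftAddHom fun z => (q.comp f).comp (Finsupp.singleAddHom (lift z))
  have hqf : ∀ x g, q (f (Finsupp.single x g)) =
      (f (Finsupp.single 0 g)).mapDomain (fun y => latticeMod k m (M x) + latticeMod k m y) := by
    intro x g
    rw [hf, hq, ← Finsupp.mapDomain_comp]
    congr 1
    ext y : 1
    exact map_add _ _ _
  have hcongr : ∀ x y, latticeMod k m x = latticeMod k m y →
      latticeMod k m (M x) = latticeMod k m (M y) := by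
    intro x y h
    rw [← sub_eq_zero, ← map_sub] at h
    obtain ⟨z, hz⟩ := exists_smul_of_latticeMod_eq_zero h
    rw [← sub_eq_zero, ← map_sub, ← map_sub, hz, map_nsmul, map_nsmul]
    ext i
    simp
  have hF : ∀ z, q (f z) = F (q z) := by
    intro z
    induction z using Finsupp.induction_linear with
    | zero => simp
    | add z w hz hw => simp only [map_add, hz, hw]
    | single x g =>
      have h1 : F (q (Finsupp.single x g)) =
          q (f (Finsupp.single (lift (latticeMod k m x)) g)) := by
        rw [hq, Finsupp.mapDomain_single]
        simp [F]
      rw [h1, hqf, hqf, hcongr _ _ (Function.surjInv_eq (latticeMod_surjective k m) _)]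
  -- `q` has finite target and `f` descends along it to `F`. Since `m` isolates `x₀` in the support
  -- of `a`, the value `a x₀ ∉ H` survives reduction.
  refine ⟨B ⊔ q.ker, le_sup_left, ?_, ?_, ?_⟩
  · have : Finite ((Fin k → ZMod m) →₀ G) := DFunLike.finite _
    have : q.ker.FiniteIndex := ⟨by rw [AddSubgroup.index_ker]; exact Nat.card_pos.ne'⟩
    exact AddSubgroup.finiteIndex_of_le (H := q.ker) le_sup_right
  · refine sup_le (hBf.trans (AddSubgroup.comap_mono le_sup_left)) fun z hz => ?_
    refine AddSubgroup.mem_sup_right ?_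
    rw [AddMonoidHom.mem_ker] at hz ⊢
    rw [hF, hz, map_zero]
  · intro hmem
    obtain ⟨b, hb, c, hc, hbc⟩ := AddSubgroup.mem_sup.1 hmem
    have h1 : q a = q b := by rw [← hbc, map_add, AddMonoidHom.mem_ker.1 hc, add_zero]
    apply hx₀
    have h2 : q a (latticeMod k m x₀) = a x₀ := by
      rw [hqapply, Finsupp.sum, Finset.sum_eq_single x₀]
      · simp
      · intro x hx hne
        exact if_neg fun h => hne (hmS x hx h)
      · intro hx
        rw [Finsupp.notMem_support_iff.1 hx, ite_self]
    rw [← h2, h1, hqapply]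
    refine sum_mem fun x _ => ?_
    beta_reduce
    split_ifs
    · exact (hBH b).1 hb x
    · exact zero_mem _

/-! ### The induced action on the group algebra. -/

section Monomial

variable {G V : Type*} [AddCommGroup G] [AddCommGroup V] {p : ℕ}

/-- The map `⊕_V G → 𝔽_p[V]` induced by a character of `G`. -/
noncomputable def toAlgebra (V : Type*) [AddCommGroup V] (π : G →+ ZMod p) :
    (V →₀ G) →+ AddMonoidAlgebra (ZMod p) V :=
  AddMonoidAlgebra.coeffAddEquiv.symm.toAddMonoidHom.comp (Finsupp.mapRange.addMonoidHom π)

theorem toAlgebra_single (π : G →+ ZMod p) (x : V) (g : G) :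
    toAlgebra V π (Finsupp.single x g) = AddMonoidAlgebra.single x (π g) := by
  simp [toAlgebra]

theorem toAlgebra_coeff (π : G →+ ZMod p) (f : V →₀ G) (x : V) :
    (toAlgebra V π f).coeff x = π (f x) := rfl

theorem toAlgebra_mapDomain (π : G →+ ZMod p) (y : V) (f : V →₀ G) :
    toAlgebra V π (f.mapDomain (y + ·)) = AddMonoidAlgebra.single y 1 * toAlgebra V π f := by
  induction f using Finsupp.induction_linear with
  | zero => simp
  | add f g hf hg => rw [Finsupp.mapDomain_add, map_add, hf, hg, map_add, mul_add]
  | single x g => rw [Finsupp.mapDomain_single, toAlgebra_single, toAlgebra_single,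
      AddMonoidAlgebra.single_mul_single, one_mul]

theorem toAlgebra_semilinear [NeZero p] (π : G →+ ZMod p) (γ : G) (s : ℕ)
    (hγ : γ ∈ torsionSup G p (p ^ (s + 1))) (hγ1 : π γ = 1)
    (hπ : ∀ g ∈ torsionSup G p (p ^ (s + 1)), (π g = 0 ↔ g ∈ torsionSup G p (p ^ s)))
    (M : V →+ V) (f : (V →₀ G) →+ (V →₀ G)) (hf : IsSemilinear M f) (z : V →₀ G)
    (hz : z ∈ torsionSup (V →₀ G) p (p ^ (s + 1))) :
    toAlgebra V π (f z) =
      toAlgebra V π (f (Finsupp.single 0 γ)) * (toAlgebra V π z).mapDomain M := by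
  have hmem : ∀ z ∈ torsionSup (V →₀ G) p (p ^ s), toAlgebra V π z = 0 := by
    intro z hz
    ext x
    rw [toAlgebra_coeff]
    have h1 := mem_torsionSup_finsupp.1 hz x
    refine (hπ _ ?_).2 h1
    obtain ⟨a, b, hab, ha⟩ := h1
    exact ⟨a, b, hab, by rw [pow_succ', mul_nsmul', ha, nsmul_zero]⟩
  have hzero : ∀ g ∈ torsionSup G p (p ^ (s + 1)), toAlgebra V π (f (Finsupp.single 0 g)) =
      (π g).val • toAlgebra V π (f (Finsupp.single 0 γ)) := by
    intro g hg
    have h1 : g - (π g).val • γ ∈ torsionSup G p (p ^ s) := by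
      refine (hπ _ (sub_mem hg (nsmul_mem hγ _))).1 ?_
      rw [map_sub, map_nsmul, hγ1, nsmul_one, ZMod.natCast_zmod_val, sub_self]
    have h2 := hmem _ (map_mem_torsionSup (f.comp (Finsupp.singleAddHom 0)) h1)
    rw [map_sub, map_sub, map_nsmul, map_nsmul, sub_eq_zero] at h2
    exact h2
  have hsingle : ∀ x, ∀ g ∈ torsionSup G p (p ^ (s + 1)),
      toAlgebra V π (f (Finsupp.single x g)) =
      toAlgebra V π (f (Finsupp.single 0 γ)) *
        (toAlgebra V π (Finsupp.single x g)).mapDomain M := by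
    intro x g hg
    rw [hf, toAlgebra_mapDomain, hzero g hg, toAlgebra_single, AddMonoidAlgebra.mapDomain_single,
      mul_comm _ (AddMonoidAlgebra.single (M x) (π g)), mul_smul_comm, ← smul_mul_assoc,
      AddMonoidAlgebra.smul_single, nsmul_one, ZMod.natCast_zmod_val]
  let Mr : AddMonoidAlgebra (ZMod p) V →+ AddMonoidAlgebra (ZMod p) V :=
    AddMonoidHom.mk' (AddMonoidAlgebra.mapDomain M) (AddMonoidAlgebra.mapDomain_add M)
  change _ = _ * Mr (toAlgebra V π z)
  rw [← Finsupp.sum_single z, Finsupp.sum]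
  simp only [map_sum, Finset.mul_sum]
  exact Finset.sum_congr rfl fun x _ => hsingle x _ (mem_torsionSup_finsupp.1 hz x)

/-- The coefficient `c` of the monomial meets the factor `c` by which `χ` transforms, and `c * c =
1`. -/
theorem linearCombination_monomial_mul {R : Type*} [CommRing R] (M : V →+ V) (v : V) (c : R)
    (hc : c * c = 1) (χ : V → R) (hχ : ∀ z, χ (M z + v) = c * χ z) (h : AddMonoidAlgebra R V) :
    Finsupp.linearCombination R χ (AddMonoidAlgebra.single v c * h.mapDomain M).coeff =
      Finsupp.linearCombination R χ h.coeff := by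
  induction h using AddMonoidAlgebra.induction_linear with
  | zero => simp
  | add f g hf hg => simp only [AddMonoidAlgebra.mapDomain_add, mul_add,
      AddMonoidAlgebra.coeff_add, map_add, hf, hg]
  | single x a =>
    rw [AddMonoidAlgebra.mapDomain_single, AddMonoidAlgebra.single_mul_single,
      AddMonoidAlgebra.coeff_single, AddMonoidAlgebra.coeff_single,
      Finsupp.linearCombination_single, Finsupp.linearCombination_single, add_comm v, hχ,
      smul_eq_mul, smul_eq_mul]
    linear_combination a * χ x * hc

end Monomial

theorem units_zmod_three : ∀ c : (ZMod 3)ˣ, c = 1 ∨ c = -1 := by decide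

/-- Units modulo `2` or `3` are `±1`. For `c = 1` any moved point works; `c = -1 ≠ 1` needs even
periods, hence odd `k` when `p = 3`. -/
theorem exists_point_with_sign_period {k p : ℕ} (hp : p.Prime)
    (hpk : (p = 2 ∧ 1 ≤ k) ∨ (p = 3 ∧ Odd k)) (M : (Fin k → ℤ) ≃+ (Fin k → ℤ))
    (hM : (oneSub M.toAddMonoidHom).range.FiniteIndex) (v : Fin k → ℤ) (c : (ZMod p)ˣ) :
    c * c = 1 ∧ ∃ w, affinePerm M v w ≠ w ∧
      ∀ j : ℤ, (affinePerm M v ^ j) w = w → c ^ j = 1 := by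
  have : Fact p.Prime := ⟨hp⟩
  have hone : c = 1 → 1 ≤ k → c * c = 1 ∧ ∃ w, affinePerm M v w ≠ w ∧
      ∀ j : ℤ, (affinePerm M v ^ j) w = w → c ^ j = 1 := by
    rintro rfl hk
    obtain ⟨w, hw⟩ := exists_affinePerm_ne M hk hM v
    exact ⟨one_mul 1, w, hw, fun j _ => one_zpow j⟩
  rcases hpk with ⟨rfl, hk⟩ | ⟨rfl, hk⟩
  · exact hone (Subsingleton.elim _ _) hk
  · have hc : c = 1 ∨ c = -1 := by
      exact units_zmod_three c
    rcases hc with rfl | rfl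
    · exact hone rfl hk.pos
    · obtain ⟨w, hw⟩ := exists_no_odd_period M hk hM v
      refine ⟨by simp, w, fun h => ?_, fun j hj => (hw j hj).neg_one_zpow⟩
      have := hw 1 (by simpa using h)
      exact Int.not_even_one this

theorem not_finiteIndex_oneSub_of_isSemilinear {G : Type*} [AddCommGroup G] [Finite G] {k p s : ℕ}
    (hp : p.Prime) (hpk : (p = 2 ∧ 1 ≤ k) ∨ (p = 3 ∧ Odd k)) (π : G →+ ZMod p) (γ : G)
    (hγ : γ ∈ torsionSup G p (p ^ (s + 1))) (hγ1 : π γ = 1)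
    (hπ : ∀ g ∈ torsionSup G p (p ^ (s + 1)), (π g = 0 ↔ g ∈ torsionSup G p (p ^ s)))
    (M : (Fin k → ℤ) ≃+ (Fin k → ℤ)) (hM : (oneSub M.toAddMonoidHom).range.FiniteIndex)
    (f f' : ((Fin k → ℤ) →₀ G) →+ ((Fin k → ℤ) →₀ G)) (hff' : ∀ z, f (f' z) = z)
    (hf : IsSemilinear M.toAddMonoidHom f) : ¬ (oneSub f).range.FiniteIndex := by
  intro hfin
  have : Fact p.Prime := ⟨hp⟩
  let B := torsionSup ((Fin k → ℤ) →₀ G) p (p ^ (s + 1))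
  have hBf : B ≤ B.comap f := fun z hz => map_mem_torsionSup f hz
  have hmul := toAlgebra_semilinear π γ s hγ hγ1 hπ M.toAddMonoidHom f hf
  have hγB : ∀ x, Finsupp.single x γ ∈ B :=
    fun x => map_mem_torsionSup (Finsupp.singleAddHom x) hγ
  obtain ⟨v, c, hvc⟩ := eq_single_of_mul_eq_one
    -- Applying the multiplication formula to a preimage of `γ` at `0` exhibits an inverse of this
    -- element.
    (u := toAlgebra (Fin k → ℤ) π (f (Finsupp.single 0 γ)))
    (w := (toAlgebra (Fin k → ℤ) π (f' (Finsupp.single 0 γ))).mapDomain M.toAddMonoidHom) (by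
      rw [← hmul _ (map_mem_torsionSup f' (hγB 0)), hff', toAlgebra_single, hγ1]; rfl)
  have hc : c ≠ 0 := by
    rintro rfl
    have h1 := hmul _ (map_mem_torsionSup f' (hγB 0))
    rw [hvc, hff', toAlgebra_single, hγ1, AddMonoidAlgebra.single_zero, zero_mul,
      AddMonoidAlgebra.single_eq_zero] at h1
    exact one_ne_zero h1
  rw [hvc] at hmul
  obtain ⟨hcc, w, hw, hwc⟩ := exists_point_with_sign_period hp hpk M hM v (Units.mk0 c hc)
  have hcc' : c * c = 1 := by simpa using congrArg Units.val hcc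
  obtain ⟨u, hu, huw⟩ := exists_orbit_representatives M hM v w hw
  have hrel := relIndex_map_oneSub_ne_zero f hfin B
    (exists_invariant_finiteIndex M.toAddMonoidHom f hf _ B (fun z => mem_torsionSup_finsupp) hBf)
  obtain ⟨t, t', htt', z, hz, hzt⟩ := exists_ne_sub_mem_of_relIndex_ne_zero hrel
    (fun t => Finsupp.single (u t) γ) (fun t => hγB _)
  obtain ⟨χ, hχ, hχ1, hχ0⟩ := exists_twisted_invariant (affinePerm M v) (Units.mk0 c hc) (u t)
    (fun j hj => hwc j (huw t j hj))
  have h1 := linearCombination_monomial_mul M.toAddMonoidHom v c hcc' χ hχ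
    (toAlgebra (Fin k → ℤ) π z)
  rw [← hmul z hz] at h1
  -- The invariant functional vanishes on `z - f z`, but it is `1` at `u t` and `0` at `u t'`, which
  -- lies in another orbit.
  have h2 := congrArg (fun a => Finsupp.linearCombination (ZMod p) χ
    (toAlgebra (Fin k → ℤ) π a).coeff) hzt
  simp only [oneSub_apply, map_sub, AddMonoidAlgebra.coeff_sub, h1, sub_self, toAlgebra_single,
    AddMonoidAlgebra.coeff_single, Finsupp.linearCombination_single, hγ1, one_smul, hχ1,
    hχ0 (u t') (fun j hj => htt' (hu t t' j hj)), sub_zero] at h2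
  exact zero_ne_one h2

open SemidirectProduct Multiplicative

/-! ### Automorphisms of the wreath product. -/

section Wreath

variable {G V : Type*} [AddCommGroup G] [AddCommGroup V]

theorem right_map_inl [Finite G] [IsAddTorsionFree V]
    (φ : RestrictedWreath G V ≃* RestrictedWreath G V)
    (a : Multiplicative (V →₀ G)) : (φ (inl a)).right = 1 := by
  have h1 : a ^ Nat.card G = 1 := by
    apply toAdd.injective
    rw [toAdd_pow, toAdd_one]
    ext x
    rw [Finsupp.smul_apply, card_nsmul_eq_zero', Finsupp.zero_apply]
  have h2 : (φ (inl a)).right ^ Nat.card G = 1 := by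
    have := congrArg rightHom (congrArg φ (congrArg (inl (φ := shiftAction G V)) h1))
    simpa only [map_pow, map_one, rightHom_eq_right] using this
  apply toAdd.injective
  have h3 := congrArg toAdd h2
  rw [toAdd_pow, toAdd_one] at h3
  exact (nsmul_eq_zero_iff_right Nat.card_pos.ne').1 h3

theorem exists_base_map [Finite G] [IsAddTorsionFree V]
    (φ : RestrictedWreath G V ≃* RestrictedWreath G V) :
    ∃ f : (V →₀ G) →+ (V →₀ G), ∀ a, φ (inl (ofAdd a)) = inl (ofAdd (f a)) := by
  have h : ∀ a, φ (inl (ofAdd a)) = inl (φ (inl (ofAdd a))).left := fun a =>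
    SemidirectProduct.ext (by simp) (by rw [right_map_inl, right_inl])
  refine ⟨AddMonoidHom.mk' (fun a => (φ (inl (ofAdd a))).left.toAdd) fun a b => ?_, fun a => ?_⟩
  · rw [← toAdd_mul]
    congr 1
    apply inl_injective (φ := shiftAction G V)
    rw [map_mul, ← h, ← h, ← h, ofAdd_add, map_mul, map_mul]
  · exact h a

theorem exists_top_map [Finite G] [IsAddTorsionFree V]
    (φ : RestrictedWreath G V ≃* RestrictedWreath G V) :
    ∃ M : V →+ V, ∀ g, (φ g).right = ofAdd (M g.right.toAdd) := by
  refine ⟨AddMonoidHom.mk' (fun y => (φ (inr (ofAdd y))).right.toAdd) fun a b => ?_, fun g => ?_⟩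
  · rw [ofAdd_add, map_mul, map_mul, mul_right, toAdd_mul]
  · conv_lhs => rw [← inl_left_mul_inr_right g]
    rw [map_mul, mul_right, right_map_inl, one_mul]
    rfl

theorem exists_top_equiv [Finite G] [IsAddTorsionFree V]
    (φ : RestrictedWreath G V ≃* RestrictedWreath G V) :
    ∃ M : V ≃+ V, ∀ g, (φ g).right = ofAdd (M g.right.toAdd) := by
  obtain ⟨M, hM⟩ := exists_top_map φ
  obtain ⟨M', hM'⟩ := exists_top_map φ.symm
  refine ⟨AddEquiv.mk' ⟨M, M', fun y => ?_, fun y => ?_⟩ (map_add M), hM⟩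
  · have := hM' (φ (inr (ofAdd y)))
    rw [MulEquiv.symm_apply_apply, hM] at this
    exact (congrArg toAdd this).symm
  · have := hM (φ.symm (inr (ofAdd y)))
    rw [MulEquiv.apply_symm_apply, hM'] at this
    exact (congrArg toAdd this).symm

/-- Shifting by `y` is conjugation by `inr y`, whose image is a base element times `M y`; the base
factor acts trivially because the base is abelian. -/
theorem isSemilinear_base_map (φ : RestrictedWreath G V ≃* RestrictedWreath G V)
    (f : (V →₀ G) →+ (V →₀ G)) (hf : ∀ a, φ (inl (ofAdd a)) = inl (ofAdd (f a)))
    (M : V ≃+ V) (hM : ∀ g, (φ g).right = ofAdd (M g.right.toAdd)) :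
    IsSemilinear M.toAddMonoidHom f := by
  intro y g
  have h1 : (inl (ofAdd (Finsupp.single y g)) : RestrictedWreath G V) =
      inr (ofAdd y) * inl (ofAdd (Finsupp.single 0 g)) * inr (ofAdd y)⁻¹ := by
    rw [← inl_aut, shiftAction_single, add_zero]
  have h2 := congrArg φ h1
  rw [hf, map_mul, map_mul, hf, map_inv, map_inv, ← inl_left_mul_inr_right (φ (inr (ofAdd y))),
    hM, right_inr, toAdd_ofAdd, mul_inv_rev] at h2
  have h3 : ∀ (l b : Multiplicative (V →₀ G)) (n : Multiplicative V),
      (inl l * inr n * inl b * ((inr n)⁻¹ * (inl l)⁻¹) : RestrictedWreath G V) =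
        inl (shiftAction G V n b) := by
    intro l b n
    have h4 : (inl l * inr n * inl b * ((inr n)⁻¹ * (inl l)⁻¹) : RestrictedWreath G V) =
        inl l * (inr n * inl b * (inr n)⁻¹) * (inl l)⁻¹ := by group
    rw [h4, ← map_inv inr, ← inl_aut, ← map_inv, ← map_mul, ← map_mul, mul_comm l,
      mul_inv_cancel_right]
  rw [h3] at h2
  have h5 := congrArg toAdd (inl_injective h2)
  rw [toAdd_ofAdd] at h5
  rw [h5]
  exact Finsupp.equivMapDomain_eq_mapDomain _ _

theorem finiteIndex_oneSub_top (φ : RestrictedWreath G V ≃* RestrictedWreath G V)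
    [Finite (Quotient (reidemeisterSetoid φ))] (M : V ≃+ V)
    (hM : ∀ g, (φ g).right = ofAdd (M g.right.toAdd)) :
    (oneSub M.toAddMonoidHom).range.FiniteIndex := by
  let F : Quotient (reidemeisterSetoid φ) → V ⧸ (oneSub M.toAddMonoidHom).range :=
    Quotient.lift (fun g => QuotientAddGroup.mk g.right.toAdd) (by
      rintro x y ⟨g, rfl⟩
      rw [QuotientAddGroup.eq]
      refine ⟨g.right.toAdd, ?_⟩
      simp only [mul_right, toAdd_mul, hM, inv_right, toAdd_inv, map_neg, toAdd_ofAdd,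
        oneSub_apply]
      change _ - M _ = _
      abel)
  have hF : Function.Surjective F := by
    intro y
    obtain ⟨y, rfl⟩ := QuotientAddGroup.mk_surjective y
    exact ⟨Quotient.mk _ (inr (ofAdd y)), rfl⟩
  have := Finite.of_surjective F hF
  exact AddSubgroup.finiteIndex_of_finite_quotient

/-- An element twisting one base element into another has its top part fixed by `M`, so it lies in
the base and the two differ by an element of `(1 - f) A`. -/
theorem finiteIndex_oneSub_base (φ : RestrictedWreath G V ≃* RestrictedWreath G V)
    [Finite (Quotient (reidemeisterSetoid φ))] (f : (V →₀ G) →+ (V →₀ G))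
    (hf : ∀ a, φ (inl (ofAdd a)) = inl (ofAdd (f a))) (M : V ≃+ V)
    (hM : ∀ g, (φ g).right = ofAdd (M g.right.toAdd))
    (hinj : Function.Injective (oneSub M.toAddMonoidHom)) :
    (oneSub f).range.FiniteIndex := by
  let F : (V →₀ G) ⧸ (oneSub f).range → Quotient (reidemeisterSetoid φ) :=
    fun a => Quotient.mk _ (inl (ofAdd a.out))
  have hF : Function.Injective F := by
    intro a b hab
    obtain ⟨g, hg⟩ := Quotient.exact hab
    have h1 := congrArg (fun x => (SemidirectProduct.right x).toAdd) hg
    simp only [mul_right, toAdd_mul, hM, inv_right, toAdd_inv, map_neg, toAdd_ofAdd,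
      right_inl, toAdd_one, add_zero] at h1
    have h2 : g.right = 1 := by
      apply toAdd.injective
      apply hinj
      rw [toAdd_one, map_zero, oneSub_apply, sub_eq_add_neg]
      exact h1.symm
    have h3 : g = inl (ofAdd g.left.toAdd) := by
      conv_lhs => rw [← inl_left_mul_inr_right g, h2, map_one, mul_one]
      rfl
    rw [h3, ← map_inv, ← ofAdd_neg, hf, ← map_mul, ← map_mul] at hg
    have h4 := congrArg toAdd (inl_injective hg)
    simp only [toAdd_mul, toAdd_ofAdd, map_neg] at h4
    rw [← QuotientAddGroup.out_eq' a, ← QuotientAddGroup.out_eq' b, QuotientAddGroup.eq]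
    refine ⟨g.left.toAdd, ?_⟩
    change _ = -Quotient.out a + Quotient.out b
    rw [h4, oneSub_apply]
    abel
  have := Finite.of_injective F hF
  exact AddSubgroup.finiteIndex_of_finite_quotient

end Wreath

end RInfty

theorem theorem2 {G : Type*} [AddCommGroup G] {ι : Type*} [Fintype ι]
    (p r d : ι → ℕ) (hp : ∀ j, (p j).Prime) (hr : ∀ j, 1 ≤ r j)
    (hinj : Function.Injective (fun j => (p j, r j)))
    (e : G ≃+ ⨁ j, (Fin (d j) → ZMod (p j ^ r j)))
    (k : ℕ) (j₀ : ι) (hd : d j₀ = 1)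
    (hpk : (p j₀ = 2 ∧ 1 ≤ k) ∨ (p j₀ = 3 ∧ Odd k)) :
    HasRInfty (RestrictedWreath G (Fin k → ℤ)) := by
  classical
  intro φ
  by_contra hne
  have hfin : Finite (Quotient (reidemeisterSetoid φ)) := by
    by_contra hinf
    rw [not_finite_iff_infinite] at hinf
    exact hne ENat.card_eq_top_of_infinite
  have hG : Finite G := by
    have : ∀ j, NeZero (p j ^ r j) := fun j => ⟨pow_ne_zero _ (hp j).ne_zero⟩
    exact Finite.of_equiv _ (e.trans (DirectSum.addEquivProd _)).toEquiv.symm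
  obtain ⟨s, hs⟩ : ∃ s, r j₀ = s + 1 := ⟨r j₀ - 1, by have := hr j₀; omega⟩
  obtain ⟨π, γ, hγ, hγ1, hπ⟩ := RInfty.exists_ulm_character p r d hp hinj e j₀ hd s hs
  obtain ⟨f, hf⟩ := RInfty.exists_base_map φ
  obtain ⟨f', hf'⟩ := RInfty.exists_base_map φ.symm
  obtain ⟨M, hM⟩ := RInfty.exists_top_equiv φ
  have hMfin := RInfty.finiteIndex_oneSub_top φ M hM
  refine RInfty.not_finiteIndex_oneSub_of_isSemilinear (hp j₀) hpk π γ hγ hγ1 hπ M hMfin f f'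
    (fun z => ?_) (RInfty.isSemilinear_base_map φ f hf M hM)
    (RInfty.finiteIndex_oneSub_base φ f hf M hM (RInfty.injective_of_finiteIndex_range _ hMfin))
  have h1 := hf (f' z)
  rw [← hf', MulEquiv.apply_symm_apply] at h1
  exact (congrArg Multiplicative.toAdd (SemidirectProduct.inl_injective h1)).symm
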